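/- **Notation.** $P_2(\mathbb R)$ is the set of Borel probability measures on $\mathbb R$ with finite second moment. For $\mu,\nu\in P_2(\mathbb R)$, $W_2(\mu,\nu)=\big(\inf_{\pi}\int|x-y|^2\,d\pi(x,y)\big)^{1/2}$, the infimum being over all couplings $\pi$ of $\mu$ and $\nu$; $\mathrm{bar}(\mu)=\int x\,d\mu(x)$; and for a probability measure $m$, $\mathrm{Ent}_m(\mu)=\int\rho\log\rho\,dm\in[0,\infty]$ if $\mu=\rho m$, and $\mathrm{Ent}_m(\mu)=\infty$ if $\mu$ is not absolutely continuous with respect to $m$. An optimal transport map from $m$ to $\mu$ is a monotone increasing (i.e. nondecreasing) map $T:\mathbb R\to\mathbb R$ with $T_\#m=\mu$ and $\int|T(x)-x|^2\,dm(x)=W_2^2(m,\mu)$. **Theorem.** Let $\mu,\nu\in P_2(\mathbb R)$. (1) Let $\kappa>0$ and let $m=e^{-V}\mathcal L^1$ be a probability measure on $\mathbb R$, where $V\in C^\infty(\mathbb R)$ is $\kappa$-convex, i.e. $V((1-t)x+ty)\le(1-t)V(x)+tV(y)-\frac{\kappa}{2}t(1-t)|x-y|^2$ for all $x,y\in\mathbb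 R$ and $t\in[0,1]$. Then $e^{-V}$ attains its maximum at a unique point $\xi_m$, there exist optimal transport maps from $m$ to $\mu$ and from $m$ to $\nu$, and for any such maps $S$ (to $\mu$) and $T$ (to $\nu$), putting $\alpha_{m,\mu}:=S(\xi_m)$ and $\alpha_{m,\nu}:=T(\xi_m)$, $$\tfrac12W_2^2(\mu,\nu)\le\tfrac1\kappa\big(\mathrm{Ent}_m(\mu)+\mathrm{Ent}_m(\nu)\big)+\Phi(m,\mu,\nu),$$ where $$\begin{aligned}\Phi(m,\mu,\nu):={}&-\alpha_{m,\nu}\,\mathrm{bar}(\mu)-\alpha_{m,\mu}\,\mathrm{bar}(\nu)+\alpha_{m,\mu}\alpha_{m,\nu}+(\alpha_{m,\mu}+\alpha_{m,\nu})(\mathrm{bar}(m)-\xi_m)\\&+\Big(\xi_m-\mathrm{bar}(m)+\tfrac{\mathrm{bar}(\mu)+\mathrm{bar}(\nu)}2\Big)^2-\Big(\mathrm{bar}(m)-\tfrac{\mathrm{bar}(\mu)+\mathrm{bar}(\nu)}2\Big)^2 .\end{aligned}$$ (2) In particular, let $m=\gamma_1$ be the standard Gaussian measure on $\mathbb R$.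 Then $\xi_{\gamma_1}=0$, optimal transport maps from $\gamma_1$ to $\mu$ and from $\gamma_1$ to $\nu$ exist, and for any such maps $S$, $T$, with $\alpha_{\gamma_1,\mu}=S(0)$ and $\alpha_{\gamma_1,\nu}=T(0)$, $$\Phi(\mu,\nu):=\Phi(\gamma_1,\mu,\nu)=-\alpha_{\gamma_1,\nu}\,\mathrm{bar}(\mu)-\alpha_{\gamma_1,\mu}\,\mathrm{bar}(\nu)+\alpha_{\gamma_1,\mu}\alpha_{\gamma_1,\nu}$$ and $$\tfrac12W_2^2(\mu,\nu)\le\mathrm{Ent}_{\gamma_1}(\mu)+\mathrm{Ent}_{\gamma_1}(\nu)+\min\{\Phi(\mu,\nu),\,-\mathrm{bar}(\mu)\,\mathrm{bar}(\nu)\}.$$ -/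

import Mathlib

open MeasureTheory ProbabilityTheory
open scoped ENNReal ContDiff

namespace SymTalagrand

/-- Membership in `P₂(ℝ)`: Borel probability measures with finite second moment. -/
structure IsP2 (μ : Measure ℝ) : Prop where
  isProbabilityMeasure : IsProbabilityMeasure μ
  memLp : MemLp (fun x : ℝ => x) 2 μ

/-- The couplings of `μ` and `ν`: measures on `ℝ × ℝ` with marginals `μ` and `ν`. -/
def couplings (μ ν : Measure ℝ) : Set (Measure (ℝ × ℝ)) :=
  {π | π.map Prod.fst = μ ∧ π.map Prod.snd = ν}

/-- The `L²`-Wasserstein distance, with values in `[0, ∞]` (finite on `P₂(ℝ)`). -/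
noncomputable def W₂ (μ ν : Measure ℝ) : ℝ≥0∞ :=
  (⨅ π ∈ couplings μ ν, ∫⁻ z, ‖z.1 - z.2‖ₑ ^ 2 ∂π) ^ (1 / 2 : ℝ)

/-- The relative entropy `Ent_m(μ) ∈ [0, ∞]` of `μ` with respect to the reference measure `m`.
For probability measures it is `∫ ρ log ρ dm` if `μ = ρ m`, and `∞` if `μ` is not absolutely
continuous with respect to `m`. -/
noncomputable def Ent (m μ : Measure ℝ) : ℝ≥0∞ := InformationTheory.klDiv μ m

/-- The barycenter of a measure on the real line. -/
noncomputable def bary (μ : Measure ℝ) : ℝ := ∫ x, x ∂μ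

/-- The measure `e^{-V} dx` on the real line. -/
noncomputable def gibbs (V : ℝ → ℝ) : Measure ℝ :=
  volume.withDensity fun x => ENNReal.ofReal (Real.exp (-V x))

/-- `ξ` is the unique point at which the density `ρ` attains its maximum. -/
def IsMode (ρ : ℝ → ℝ) (ξ : ℝ) : Prop := ∀ x, x ≠ ξ → ρ x < ρ ξ

/-- `T` is an optimal transport map from `m` to `μ` for the quadratic cost: it pushes `m` forward
to `μ`, it attains the Wasserstein distance, and it is the gradient of a convex function. On the
real line the last property, for a map that is defined everywhere, means that `T` is monotone: the
selections of the subdifferential of a finite convex function are the monotone functions. (Hence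
`T` is measurable.) -/
structure IsOptimalTransportMap (m μ : Measure ℝ) (T : ℝ → ℝ) : Prop where
  monotone : Monotone T
  map_eq : m.map T = μ
  cost_eq : ∫⁻ x, ‖T x - x‖ₑ ^ 2 ∂m = W₂ m μ ^ 2

/-- The correction term `Φ(m, μ, ν)`, as a function of the mode `ξ = ξ_m` and of the images
`α = α_{m,μ}`, `β = α_{m,ν}` of the mode under the optimal transport maps to `μ` and `ν`. -/
noncomputable def Phi (m μ ν : Measure ℝ) (ξ α β : ℝ) : ℝ :=
  -β * bary μ - α * bary ν + α * β + (α + β) * (bary m - ξ)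
    + (ξ - bary m + (bary μ + bary ν) / 2) ^ 2 - (bary m - (bary μ + bary ν) / 2) ^ 2

end SymTalagrand

/-!
Let `m = e^{-V} dx` and let `S`, `T` be monotone maps transporting `m` to `μ` and `ν`. The coupling
`(S, T)` of `μ` and `ν` gives `W₂²(μ, ν) ≤ ∫ (S - T)² dm`, so it suffices to bound this integral.
Only the case of finite entropies matters; then `μ` and `ν` are absolutely continuous, `S` and `T`
are strictly increasing, and the chain rule for `F_μ ∘ S = F_m` gives
`log (dμ/dm) ∘ S = V ∘ S - V - log S'` almost everywhere (`ae_llr_comp_eq`), hence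
`Ent_m(μ) = ∫ (V(S) - V - log S') dm`, and likewise for `T`.

Suppose that `S - α` and `T - β` both change sign at a point `p`, and that `V'(x) - κ (x - ξ)` has
the sign of `x - p`. Let `u = ± √((S - α)(T - β))` be their signed geometric mean. Three facts
combine: `V` lies above its tangent parabolas; `2 |u| ≤ |S - α| + |T - β|`; and
`log S' + log T' ≤ 2 (u' - 1)`, which is `log t ≤ t - 1` applied to the two summands of `2 u'`.
They bound the integrand of `Ent_m(μ) + Ent_m(ν) - κ/2 ∫ (S - T)² dm + κ Φ` from below by
`2 (V' v - v')` with `v(x) = u(x) - x + const`, up to terms of integral zero. Since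
`(V' v - v') e^{-V} = -(v e^{-V})'`, its integral is nonnegative: `v e^{-V}` is integrable, and the
jumps and the singular part of the increasing function `u` have the favourable sign
(`integral_nonneg_of_neg_deriv_le`, `mul_integral_sq_le`).

For general `V` the point `p` is the mode `ξ`, with `α = S(ξ)` and `β = T(ξ)`; strong convexity
gives the sign of `V'(x) - κ (x - ξ)`. For the Gaussian measure this difference vanishes
identically, so every `p` is allowed: `p = 0` gives `Φ(μ, ν)`, and a point where `S` crosses its
mean `α = bar(μ)`, with `β = T(p)`, gives `-bar(μ) bar(ν)`.

Optimal maps are the monotone ones: existence comes from quantile functions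
(`exists_monotone_map_eq`), and optimality from Kantorovich duality with a primitive of the map as
potential (`integral_mul_le_of_coupling`).
-/

namespace SymTalagrand

open Filter Set
open scoped Topology

/-! ### Monotone transport maps on the line -/

theorem strictMono_cdf {m : Measure ℝ} [IsProbabilityMeasure m] (hm : volume ≪ m) :
    StrictMono (cdf m) := by
  intro x y hxy
  refine lt_of_le_of_ne (monotone_cdf m hxy.le) fun h => ?_
  have h1 : m (Ioc x y) = 0 := by
    rw [← measure_cdf m, StieltjesFunction.measure_Ioc, h, sub_self, ENNReal.ofReal_zero]
  have h2 := hm h1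
  rw [Real.volume_Ioc, ENNReal.ofReal_eq_zero] at h2
  linarith

theorem continuous_cdf {m : Measure ℝ} [IsProbabilityMeasure m] [NullSingletonClass m] :
    Continuous (cdf m) := by
  rw [continuous_iff_continuousAt]
  intro x
  rw [(monotone_cdf m).continuousAt_iff_leftLim_eq_rightLim, StieltjesFunction.rightLim_eq]
  have h : (cdf m).measure {x} = 0 := by rw [measure_cdf]; exact measure_singleton x
  rw [StieltjesFunction.measure_singleton, ENNReal.ofReal_eq_zero] at h
  exact le_antisymm ((monotone_cdf m).leftLim_le le_rfl) (by linarith)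

theorem cdf_pos_of_volume_ac {m : Measure ℝ} [IsProbabilityMeasure m] (hm : volume ≪ m) (x : ℝ) :
    0 < cdf m x :=
  (cdf_nonneg m (x - 1)).trans_lt (strictMono_cdf hm (by linarith))

theorem cdf_lt_one_of_volume_ac {m : Measure ℝ} [IsProbabilityMeasure m] (hm : volume ≪ m)
    (x : ℝ) : cdf m x < 1 :=
  (strictMono_cdf hm (by linarith : x < x + 1)).trans_le (cdf_le_one m (x + 1))

/-- The probability integral transform: `cdf m` is uniformly distributed on `[0, 1]` under `m`. -/
theorem measure_cdf_le {m : Measure ℝ} [IsProbabilityMeasure m] [NullSingletonClass m]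
    (hm : volume ≪ m) {t : ℝ} (h0 : 0 ≤ t) (h1 : t ≤ 1) : m {x | cdf m x ≤ t} = ENNReal.ofReal t := by
  rcases h0.eq_or_lt with rfl | h0
  · have : {x | cdf m x ≤ 0} = ∅ := by
      ext x; simpa using cdf_pos_of_volume_ac hm x
    rw [this]; simp
  rcases h1.eq_or_lt with rfl | h1
  · have : {x | cdf m x ≤ 1} = univ := by
      ext x; simpa using cdf_le_one m x
    rw [this]; simp
  obtain ⟨x₀, rfl⟩ : t ∈ range (cdf m) := by
    refine mem_range_of_exists_le_of_exists_ge continuous_cdf ?_ ?_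
    · exact ((tendsto_cdf_atBot m).eventually_le_const h0).exists
    · exact ((tendsto_cdf_atTop m).eventually_const_le h1).exists
  rw [ofReal_cdf]
  congr 1
  ext x
  exact (strictMono_cdf hm).le_iff_le

/-- The quantile function of `μ` composed with the distribution function of `m` transports `m`
to `μ`. -/
theorem exists_monotone_map_eq {m μ : Measure ℝ} [IsProbabilityMeasure m] [NullSingletonClass m]
    (hm : volume ≪ m) [IsProbabilityMeasure μ] :
    ∃ S : ℝ → ℝ, Monotone S ∧ m.map S = μ := by
  set S : ℝ → ℝ := fun x => sInf {y | cdf m x ≤ cdf μ y} with hS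
  have hne (x : ℝ) : {y | cdf m x ≤ cdf μ y}.Nonempty :=
    ((tendsto_cdf_atTop μ).eventually_const_le (cdf_lt_one_of_volume_ac hm x)).exists
  have hbdd (x : ℝ) : BddBelow {y | cdf m x ≤ cdf μ y} := by
    obtain ⟨z, hz⟩ :=
      ((tendsto_cdf_atBot μ).eventually_lt_const (cdf_pos_of_volume_ac hm x)).exists
    refine ⟨z, fun y hy => ?_⟩
    by_contra! h
    exact absurd (hy.trans (monotone_cdf μ h.le)) (not_le.2 hz)
  have gc (x y : ℝ) : S x ≤ y ↔ cdf m x ≤ cdf μ y := by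
    refine ⟨fun h => ?_, fun h => csInf_le (hbdd x) h⟩
    -- right continuity of `cdf μ` puts the infimum into the set
    have hlim : Tendsto (cdf μ) (𝓝[>] y) (𝓝 (cdf μ y)) :=
      ((cdf μ).right_continuous y).tendsto.mono_left (nhdsWithin_mono _ Ioi_subset_Ici_self)
    refine ge_of_tendsto hlim ?_
    filter_upwards [self_mem_nhdsWithin] with z hz
    obtain ⟨w, hw, hwz⟩ := exists_lt_of_csInf_lt (hne x) (lt_of_le_of_lt h hz)
    exact hw.trans (monotone_cdf μ hwz.le)
  have hmono : Monotone S := fun x x' hx =>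
    (gc _ _).2 ((monotone_cdf m hx).trans ((gc x' (S x')).1 le_rfl))
  refine ⟨S, hmono, ?_⟩
  have : IsProbabilityMeasure (m.map S) :=
    Measure.isProbabilityMeasure_map hmono.measurable.aemeasurable
  refine Measure.ext_of_Iic _ _ fun y => ?_
  rw [Measure.map_apply hmono.measurable measurableSet_Iic, ← ofReal_cdf μ y,
    ← measure_cdf_le hm (cdf_nonneg μ y) (cdf_le_one μ y)]
  congr 1
  ext x
  exact gc x y

theorem lintegral_enorm_sq_eq {α : Type*} [MeasurableSpace α] {π : Measure α} {f : α → ℝ}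
    (hf : MemLp f 2 π) : ∫⁻ z, ‖f z‖ₑ ^ 2 ∂π = ENNReal.ofReal (∫ z, f z ^ 2 ∂π) := by
  rw [ofReal_integral_eq_lintegral_ofReal hf.integrable_sq (ae_of_all _ fun z => sq_nonneg _)]
  refine lintegral_congr fun z => ?_
  rw [← ofReal_norm, ← ENNReal.ofReal_pow (norm_nonneg _), Real.norm_eq_abs, sq_abs]

theorem integral_sub_sq {α : Type*} [MeasurableSpace α] {π : Measure α} {f g : α → ℝ}
    (hf : MemLp f 2 π) (hg : MemLp g 2 π) :
    ∫ z, (f z - g z) ^ 2 ∂π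
      = ∫ z, f z ^ 2 ∂π - 2 * ∫ z, f z * g z ∂π + ∫ z, g z ^ 2 ∂π := by
  have hfg : Integrable (fun z => f z * g z) π := MemLp.integrable_mul hf hg
  have h : Integrable (fun z => f z ^ 2 - 2 * (f z * g z)) π :=
    hf.integrable_sq.sub (hfg.const_mul 2)
  have heq : (fun z => (f z - g z) ^ 2) = fun z => (f z ^ 2 - 2 * (f z * g z)) + g z ^ 2 := by
    ext z; ring
  rw [heq, integral_add h hg.integrable_sq, integral_sub hf.integrable_sq (hfg.const_mul 2),
    integral_const_mul]

theorem W₂_sq (μ ν : Measure ℝ) :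
    W₂ μ ν ^ 2 = ⨅ π ∈ couplings μ ν, ∫⁻ z, ‖z.1 - z.2‖ₑ ^ 2 ∂π := by
  rw [W₂, ← ENNReal.rpow_natCast, ← ENNReal.rpow_mul]
  norm_num

theorem W₂_sq_le_of_map {m μ ν : Measure ℝ} {S T : ℝ → ℝ} (hS : Measurable S) (hT : Measurable T)
    (hSμ : m.map S = μ) (hTν : m.map T = ν) :
    W₂ μ ν ^ 2 ≤ ∫⁻ x, ‖S x - T x‖ₑ ^ 2 ∂m := by
  rw [W₂_sq]
  have hmem : m.map (fun x => (S x, T x)) ∈ couplings μ ν := by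
    constructor
    · rw [Measure.map_map measurable_fst (hS.prodMk hT), ← hSμ]; rfl
    · rw [Measure.map_map measurable_snd (hS.prodMk hT), ← hTν]; rfl
  refine (iInf₂_le _ hmem).trans_eq ?_
  exact lintegral_map (f := fun z : ℝ × ℝ => ‖z.1 - z.2‖ₑ ^ 2) (by fun_prop) (hS.prodMk hT)

/-- A monotone function is a selection of the subdifferential of its primitive. -/
theorem add_mul_le_integral {S : ℝ → ℝ} (hS : Monotone S) (x z : ℝ) :
    (∫ t in (0)..x, S t) + S x * (z - x) ≤ ∫ t in (0)..z, S t := by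
  have hi (a b : ℝ) : IntervalIntegrable S volume a b := hS.intervalIntegrable
  rw [← intervalIntegral.integral_add_adjacent_intervals (hi 0 x) (hi x z)]
  gcongr
  rcases le_total x z with h | h
  · have := intervalIntegral.integral_mono_on h (intervalIntegrable_const (c := S x)) (hi x z)
      fun t ht => hS ht.1
    rwa [intervalIntegral.integral_const, smul_eq_mul, mul_comm] at this
  · have := intervalIntegral.integral_mono_on h (hi z x) (intervalIntegrable_const (c := S x))
      fun t ht => hS ht.2
    rw [intervalIntegral.integral_const, smul_eq_mul] at this
    rw [intervalIntegral.integral_symm]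
    linarith

/-- Kantorovich duality for a monotone map: with `φ` a primitive of `S` and `φ*` its conjugate,
`x y ≤ φ(x) + φ*(y)`, with equality on the graph of `S`; so no coupling has a larger correlation
than the one induced by `S`. The conjugate is a supremum over the rationals, which makes it
measurable, and it is finite on the range of `S`, hence almost everywhere for the image measure. -/
theorem integral_mul_le_of_coupling {m : Measure ℝ} [IsProbabilityMeasure m]
    (hm : MemLp (fun x : ℝ => x) 2 m) {S : ℝ → ℝ} (hS : Monotone S) (hS2 : MemLp S 2 m)
    {π : Measure (ℝ × ℝ)} (h1 : π.map Prod.fst = m) (h2 : π.map Prod.snd = m.map S) :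
    ∫ z, z.1 * z.2 ∂π ≤ ∫ x, x * S x ∂m := by
  have hSm : Measurable S := hS.measurable
  set φ : ℝ → ℝ := fun x => ∫ t in (0)..x, S t with hφ
  have hφc : Continuous φ :=
    intervalIntegral.continuous_primitive (fun a b => hS.intervalIntegrable) 0
  set ψ : ℝ → ℝ := fun y => ⨆ q : ℚ, ((q : ℝ) * y - φ q) with hψ
  set B : Set ℝ := {y | BddAbove (range fun q : ℚ => (q : ℝ) * y - φ q)} with hB
  have hψm : Measurable ψ := Measurable.iSup fun q => by fun_prop
  have hBm : MeasurableSet B := measurableSet_bddAbove_range fun q => by fun_prop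
  have hconj (x : ℝ) (q : ℚ) : (q : ℝ) * S x - φ q ≤ x * S x - φ x := by
    have := add_mul_le_integral hS x q
    simp only [hφ]
    linarith
  have hSB (x : ℝ) : S x ∈ B := ⟨x * S x - φ x, by rintro _ ⟨q, rfl⟩; exact hconj x q⟩
  have hyoung {y : ℝ} (hy : y ∈ B) (x : ℝ) : x * y ≤ φ x + ψ y := by
    have hcl : IsClosed {x : ℝ | x * y ≤ φ x + ψ y} :=
      isClosed_le (by fun_prop) (by fun_prop)
    have hd : Dense {x : ℝ | x * y ≤ φ x + ψ y} := by
      refine (Rat.denseRange_cast (𝕜 := ℝ)).mono ?_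
      rintro _ ⟨q, rfl⟩
      have := le_ciSup hy q
      simp only [Set.mem_ofPred_eq, hψ]
      linarith
    have := hcl.closure_eq ▸ hd x
    exact this
  have hψS (x : ℝ) : ψ (S x) = x * S x - φ x := by
    refine le_antisymm (ciSup_le (hconj x)) ?_
    have := hyoung (hSB x) x
    linarith
  have hxi : Integrable (fun x : ℝ => x) m := hm.integrable (by norm_num)
  have hxS : Integrable (fun x => x * S x) m := MemLp.integrable_mul hm hS2
  have hφ0 : φ 0 = 0 := by simp [hφ]
  have hφi : Integrable φ m := by
    refine Integrable.mono' ((hxS.abs).add ((hxi.const_mul (S 0)).abs))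
      hφc.aestronglyMeasurable (ae_of_all _ fun x => ?_)
    have e1 := add_mul_le_integral hS x 0
    have e2 := add_mul_le_integral hS 0 x
    change φ x + _ ≤ φ 0 at e1
    change φ 0 + _ ≤ φ x at e2
    rw [hφ0] at e1 e2
    simp only [Pi.add_apply, Real.norm_eq_abs]
    rw [abs_le]
    constructor
    · have := neg_abs_le (S 0 * x)
      have := abs_nonneg (x * S x)
      linarith
    · have := le_abs_self (x * S x)
      have := abs_nonneg (S 0 * x)
      linarith
  have hψi : Integrable ψ (m.map S) := by
    rw [integrable_map_measure hψm.aestronglyMeasurable hSm.aemeasurable]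
    refine (hxS.sub hφi).congr (ae_of_all _ fun x => ?_)
    simp [hψS]
  have hfst : Integrable (fun z : ℝ × ℝ => φ z.1) π := by
    rw [← h1] at hφi
    exact hφi.comp_measurable measurable_fst
  have hsnd : Integrable (fun z : ℝ × ℝ => ψ z.2) π := by
    rw [← h2] at hψi
    exact hψi.comp_measurable measurable_snd
  have hae : ∀ᵐ z ∂π, z.2 ∈ B := by
    have : ∀ᵐ y ∂(π.map Prod.snd), y ∈ B := by
      rw [h2]
      exact (ae_map_iff hSm.aemeasurable hBm).2 (ae_of_all _ hSB)
    exact ae_of_ae_map measurable_snd.aemeasurable this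
  have hz1 : MemLp (fun z : ℝ × ℝ => z.1) 2 π := by
    rw [← h1] at hm
    exact hm.comp_of_map measurable_fst.aemeasurable
  have hz2 : MemLp (fun z : ℝ × ℝ => z.2) 2 π := by
    have : MemLp (fun y : ℝ => y) 2 (π.map Prod.snd) := by
      rw [h2]
      exact (memLp_map_measure_iff aestronglyMeasurable_id hSm.aemeasurable).2 hS2
    exact this.comp_of_map measurable_snd.aemeasurable
  calc ∫ z, z.1 * z.2 ∂π ≤ ∫ z, (φ z.1 + ψ z.2) ∂π := by
        refine integral_mono_ae (MemLp.integrable_mul hz1 hz2) (hfst.add hsnd) ?_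
        filter_upwards [hae] with z hz using hyoung hz z.1
    _ = ∫ x, φ x ∂m + ∫ x, ψ (S x) ∂m := by
        rw [integral_add hfst hsnd]
        congr 1
        · rw [← h1, integral_map measurable_fst.aemeasurable hφc.aestronglyMeasurable]
        · rw [← integral_map hSm.aemeasurable hψm.aestronglyMeasurable, ← h2,
            integral_map measurable_snd.aemeasurable hψm.aestronglyMeasurable]
    _ = ∫ x, x * S x ∂m := by
        simp only [hψS]
        rw [integral_sub hxS hφi]
        ring

theorem IsP2.memLp_of_map {m μ : Measure ℝ} (hμ : IsP2 μ) {S : ℝ → ℝ} (hS : Monotone S)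
    (h : m.map S = μ) : MemLp S 2 m := by
  have := hμ.memLp
  rw [← h] at this
  exact (memLp_map_measure_iff aestronglyMeasurable_id hS.measurable.aemeasurable).1 this

theorem isOptimalTransportMap_of_monotone {m μ : Measure ℝ} (hm : IsP2 m) (hμ : IsP2 μ)
    {S : ℝ → ℝ} (hS : Monotone S) (h : m.map S = μ) : IsOptimalTransportMap m μ S := by
  refine ⟨hS, h, le_antisymm ?_ ?_⟩
  · have := hm.isProbabilityMeasure
    have hS2 := hμ.memLp_of_map hS h
    rw [W₂_sq]
    refine le_iInf₂ fun π hπ => ?_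
    obtain ⟨h1, h2⟩ := hπ
    have hz1 : MemLp (fun z : ℝ × ℝ => z.1) 2 π := by
      have := hm.memLp
      rw [← h1] at this
      exact this.comp_of_map measurable_fst.aemeasurable
    have hz2 : MemLp (fun z : ℝ × ℝ => z.2) 2 π := by
      have := hμ.memLp
      rw [← h2] at this
      exact this.comp_of_map measurable_snd.aemeasurable
    have e1 : ∫ z, z.1 ^ 2 ∂π = ∫ x, x ^ 2 ∂m := by
      rw [← h1, integral_map measurable_fst.aemeasurable (by fun_prop)]
    have e2 : ∫ z, z.2 ^ 2 ∂π = ∫ x, S x ^ 2 ∂m := by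
      rw [← integral_map (f := fun y : ℝ => y ^ 2) hS.measurable.aemeasurable (by fun_prop), h,
        ← h2, integral_map measurable_snd.aemeasurable (by fun_prop)]
    have e3 := integral_mul_le_of_coupling hm.memLp hS hS2 h1 (h2.trans h.symm)
    refine (lintegral_enorm_sq_eq (hS2.sub hm.memLp)).trans_le
      (le_of_le_of_eq ?_ (lintegral_enorm_sq_eq (hz1.sub hz2)).symm)
    refine ENNReal.ofReal_le_ofReal ?_
    simp only [Pi.sub_apply]
    rw [integral_sub_sq hS2 hm.memLp, integral_sub_sq hz1 hz2]
    simp only [mul_comm (S _)]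
    rw [e1, e2]
    linarith
  · refine (W₂_sq_le_of_map measurable_id hS.measurable Measure.map_id h).trans_eq ?_
    refine lintegral_congr fun x => ?_
    rw [← enorm_neg]
    simp

theorem exists_isOptimalTransportMap {m μ : Measure ℝ} [NullSingletonClass m] (hac : volume ≪ m)
    (hm : IsP2 m) (hμ : IsP2 μ) : ∃ S, IsOptimalTransportMap m μ S := by
  have := hm.isProbabilityMeasure
  have := hμ.isProbabilityMeasure
  obtain ⟨S, hS, h⟩ := exists_monotone_map_eq (μ := μ) hac
  exact ⟨S, isOptimalTransportMap_of_monotone hm hμ hS h⟩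

/-! ### An integrated form of integration by parts -/

/-- If `f` is integrable, locally of the form monotone minus linear, and `-f' ≤ G` almost
everywhere, then `∫ G ≥ 0`: upward jumps and the singular part of `f` have the favourable sign, and
the boundary terms `f (±R)` vanish along a sequence since `f` is integrable. -/
theorem integral_nonneg_of_neg_deriv_le {f G : ℝ → ℝ} (hf : Integrable f) (hG : Integrable G)
    (hmono : ∀ R, ∃ C, MonotoneOn (fun x => f x + C * x) (Icc (-R) R))
    (hle : ∀ᵐ x, ∃ d, HasDerivAt f d x ∧ -d ≤ G x) : 0 ≤ ∫ x, G x := by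
  have key (R : ℝ) (hR : 0 ≤ R) : -(f R - f (-R)) ≤ ∫ x in (-R)..R, G x := by
    obtain ⟨C, hC⟩ := hmono R
    have hRR : -R ≤ R := by linarith
    have hC' : MonotoneOn (fun x => f x + C * x) (uIcc (-R) R) := by rwa [uIcc_of_le hRR]
    have h1 := hC'.intervalIntegral_deriv_mem_uIcc
    have h2 : f (-R) + C * (-R) ≤ f R + C * R :=
      hC ⟨le_rfl, hRR⟩ ⟨hRR, le_rfl⟩ hRR
    rw [uIcc_of_le (by linarith)] at h1
    have hGi : IntervalIntegrable G volume (-R) R := hG.intervalIntegrable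
    have h3 : ∫ x in (-R)..R, (C - G x) ≤ ∫ x in (-R)..R, deriv (fun x => f x + C * x) x := by
      refine intervalIntegral.integral_mono_ae hRR
        (intervalIntegrable_const.sub hGi) hC'.intervalIntegrable_deriv ?_
      filter_upwards [hle] with x ⟨d, hd, hdG⟩
      have : HasDerivAt (fun x => f x + C * x) (d + C * 1) x :=
        hd.add ((hasDerivAt_id x).const_mul C)
      rw [this.deriv]
      linarith
    rw [intervalIntegral.integral_sub intervalIntegrable_const hGi,
      intervalIntegral.integral_const, smul_eq_mul] at h3
    linarith [h1.2]
  by_contra! hneg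
  have hlim : Tendsto (fun R : ℝ => ∫ x in (-R)..R, G x) atTop (𝓝 (∫ x, G x)) :=
    intervalIntegral_tendsto_integral hG tendsto_neg_atTop_atBot tendsto_id
  have hev : ∀ᶠ R in atTop, ∫ x in (-R)..R, G x < (∫ x, G x) / 2 :=
    hlim.eventually_lt_const (by linarith)
  obtain ⟨R₀, hR₀⟩ := (hev.and (eventually_ge_atTop 0)).exists_forall_of_atTop
  have hh : Integrable fun R => f R - f (-R) := hf.sub hf.comp_neg
  -- otherwise `f R - f (-R)` would be bounded below by a positive constant near `∞`
  have hconst : IntegrableOn (fun _ : ℝ => -(∫ x, G x) / 2) (Ioi R₀) := by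
    refine Integrable.mono' hh.integrableOn aestronglyMeasurable_const ?_
    filter_upwards [ae_restrict_mem measurableSet_Ioi] with R hR
    obtain ⟨e1, e2⟩ := hR₀ R (le_of_lt hR)
    rw [Real.norm_eq_abs, abs_of_pos (by linarith)]
    linarith [key R e2]
  rw [integrableOn_const_iff] at hconst
  rcases hconst with h | h
  · rw [enorm_eq_zero] at h
    linarith
  · simp at h

theorem exists_lipschitz_Icc {w : ℝ → ℝ} (hw : ContDiff ℝ 1 w) (a b : ℝ) :
    ∃ K, ∀ x ∈ Icc a b, ∀ y ∈ Icc a b, |w y - w x| ≤ K * |y - x| := by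
  obtain ⟨K, hK⟩ := hw.contDiffOn.exists_lipschitzOnWith one_ne_zero (convex_Icc a b) isCompact_Icc
  exact ⟨K, fun x hx y hy => by simpa [Real.dist_eq] using hK.dist_le_mul y hy x hx⟩

theorem exists_monotoneOn_mul_add {u w h : ℝ → ℝ} (hu : Monotone u) (hw : ContDiff ℝ 1 w)
    (hw0 : ∀ x, 0 ≤ w x) (hh : ContDiff ℝ 1 h) (a b : ℝ) :
    ∃ C, MonotoneOn (fun x => (u x * w x + h x) + C * x) (Icc a b) := by
  obtain ⟨K, hK⟩ := exists_lipschitz_Icc hw a b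
  obtain ⟨K', hK'⟩ := exists_lipschitz_Icc hh a b
  refine ⟨(|u a| + |u b|) * K + K', fun x hx y hy hxy => ?_⟩
  have h1 := hK x hx y hy
  have h2 := hK' x hx y hy
  rw [abs_of_nonneg (sub_nonneg.2 hxy)] at h1 h2
  have h3 : |u x| ≤ |u a| + |u b| := by
    rw [abs_le]
    have := hu hx.1
    have := hu hx.2
    constructor
    · linarith [neg_abs_le (u a), abs_nonneg (u b)]
    · linarith [le_abs_self (u b), abs_nonneg (u a)]
  have h4 : -((|u a| + |u b|) * (K * (y - x))) ≤ u x * (w y - w x) := by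
    refine (abs_le.1 ?_).1
    rw [abs_mul]
    exact mul_le_mul h3 h1 (abs_nonneg _) (by positivity)
  have h5 : 0 ≤ (u y - u x) * w y := mul_nonneg (sub_nonneg.2 (hu hxy)) (hw0 y)
  have h6 := (abs_le.1 h2).1
  simp only
  linarith

/-! ### The signed geometric mean of two increasing functions -/

/-- The signed geometric mean `± √(a b)` of two functions that are both negative to the left of `p`
and both positive to the right of `p`, with the same sign as `a` and `b`; its value at `p` is
`0`. -/
noncomputable def signedGeomMean (p : ℝ) (a b : ℝ → ℝ) (x : ℝ) : ℝ :=
  if p < x then √(a x * b x) else if x < p then -√(a x * b x) else 0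

/-- `a` is negative to the left of `p` and positive to the right of `p`. -/
def CrossesZeroAt (a : ℝ → ℝ) (p : ℝ) : Prop :=
  (∀ x, p < x → 0 < a x) ∧ ∀ x, x < p → a x < 0

section

variable {p : ℝ} {a b : ℝ → ℝ}

theorem signedGeomMean_of_lt {x : ℝ} (hx : p < x) : signedGeomMean p a b x = √(a x * b x) :=
  if_pos hx

theorem signedGeomMean_of_gt {x : ℝ} (hx : x < p) : signedGeomMean p a b x = -√(a x * b x) := by
  rw [signedGeomMean, if_neg hx.le.not_gt, if_pos hx]

theorem signedGeomMean_self : signedGeomMean p a b p = 0 := by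
  simp [signedGeomMean]

theorem monotone_signedGeomMean (ha : Monotone a) (hb : Monotone b) (hap : CrossesZeroAt a p)
    (hbp : CrossesZeroAt b p) : Monotone (signedGeomMean p a b) := by
  intro x y hxy
  rcases lt_trichotomy p x with hx | rfl | hx
  · have hy := hx.trans_le hxy
    rw [signedGeomMean_of_lt hx, signedGeomMean_of_lt hy]
    exact Real.sqrt_le_sqrt (mul_le_mul (ha hxy) (hb hxy) (hbp.1 x hx).le (hap.1 y hy).le)
  · rw [signedGeomMean_self]
    rcases hxy.eq_or_lt with rfl | hy
    · rw [signedGeomMean_self]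
    · rw [signedGeomMean_of_lt hy]
      positivity
  · rw [signedGeomMean_of_gt hx]
    rcases lt_trichotomy p y with hy | rfl | hy
    · rw [signedGeomMean_of_lt hy]
      linarith [Real.sqrt_nonneg (a x * b x), Real.sqrt_nonneg (a y * b y)]
    · rw [signedGeomMean_self]
      linarith [Real.sqrt_nonneg (a x * b x)]
    · rw [signedGeomMean_of_gt hy, neg_le_neg_iff]
      refine Real.sqrt_le_sqrt ?_
      have := mul_le_mul (neg_le_neg (ha hxy)) (neg_le_neg (hb hxy))
        (neg_nonneg.2 (hbp.2 y hy).le) (neg_nonneg.2 (hap.2 x hx).le)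
      linarith

theorem mul_pos_of_crossesZeroAt (hap : CrossesZeroAt a p) (hbp : CrossesZeroAt b p) {x : ℝ}
    (hx : x ≠ p) : 0 < a x * b x := by
  rcases hx.lt_or_gt with h | h
  · exact mul_pos_of_neg_of_neg (hap.2 x h) (hbp.2 x h)
  · exact mul_pos (hap.1 x h) (hbp.1 x h)

theorem signedGeomMean_sq (hap : CrossesZeroAt a p) (hbp : CrossesZeroAt b p) {x : ℝ}
    (hx : x ≠ p) : signedGeomMean p a b x ^ 2 = a x * b x := by
  have h := (mul_pos_of_crossesZeroAt hap hbp hx).le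
  rcases hx.lt_or_gt with hx | hx
  · rw [signedGeomMean_of_gt hx, neg_sq, Real.sq_sqrt h]
  · rw [signedGeomMean_of_lt hx, Real.sq_sqrt h]

theorem abs_signedGeomMean_le (hap : CrossesZeroAt a p) (hbp : CrossesZeroAt b p) (x : ℝ) :
    |signedGeomMean p a b x| ≤ |a x| + |b x| := by
  rcases eq_or_ne x p with rfl | hx
  · rw [signedGeomMean_self, abs_zero]; positivity
  · refine abs_le_of_sq_le_sq ?_ (by positivity)
    rw [signedGeomMean_sq hap hbp hx]
    have := abs_mul_abs_self (a x)
    have := abs_mul_abs_self (b x)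
    have := le_abs_self (a x * b x)
    rw [abs_mul] at this
    nlinarith [mul_nonneg (abs_nonneg (a x)) (abs_nonneg (b x))]

/-- The inequality of arithmetic and geometric means on the right of `p`. -/
theorem two_mul_signedGeomMean_le (hap : CrossesZeroAt a p) (hbp : CrossesZeroAt b p) {x : ℝ}
    (hx : p < x) : 2 * signedGeomMean p a b x ≤ a x + b x := by
  have h1 := signedGeomMean_sq hap hbp hx.ne'
  have h2 := hap.1 x hx
  have h3 := hbp.1 x hx
  nlinarith [sq_nonneg (a x - b x)]

/-- The inequality of arithmetic and geometric means on the left of `p`. -/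
theorem le_two_mul_signedGeomMean (hap : CrossesZeroAt a p) (hbp : CrossesZeroAt b p) {x : ℝ}
    (hx : x < p) : a x + b x ≤ 2 * signedGeomMean p a b x := by
  have h1 := signedGeomMean_sq hap hbp hx.ne
  have h2 := hap.2 x hx
  have h3 := hbp.2 x hx
  nlinarith [sq_nonneg (a x - b x)]

/-- The derivative of the geometric mean `u` satisfies `log a' + log b' ≤ 2 (u' - 1)`, by
`log t ≤ t - 1` applied to the two summands of `2 u' = a' √(b / a) + b' √(a / b)`. -/
theorem exists_hasDerivAt_signedGeomMean (hap : CrossesZeroAt a p) (hbp : CrossesZeroAt b p)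
    {x a' b' : ℝ} (hx : x ≠ p) (ha : HasDerivAt a a' x) (hb : HasDerivAt b b' x) (ha' : 0 < a')
    (hb' : 0 < b') :
    ∃ d, HasDerivAt (signedGeomMean p a b) d x ∧ Real.log a' + Real.log b' ≤ 2 * (d - 1) := by
  have hab := mul_pos_of_crossesZeroAt hap hbp hx
  have hr : 0 < √(a x * b x) := Real.sqrt_pos.2 hab
  have hr2 : √(a x * b x) ^ 2 = a x * b x := Real.sq_sqrt hab.le
  have hd := (ha.mul hb).sqrt hab.ne'
  have hlog {s t : ℝ} (hs : 0 < s) (ht : 0 < t) (hst : s * t = 1) :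
      Real.log a' + Real.log b' ≤ a' * s + b' * t - 2 := by
    have h1 := Real.log_le_sub_one_of_pos (mul_pos ha' hs)
    have h2 := Real.log_le_sub_one_of_pos (mul_pos hb' ht)
    rw [Real.log_mul ha'.ne' hs.ne'] at h1
    rw [Real.log_mul hb'.ne' ht.ne'] at h2
    have h3 : Real.log s + Real.log t = 0 := by
      rw [← Real.log_mul hs.ne' ht.ne', hst, Real.log_one]
    linarith
  rcases hx.lt_or_gt with h | h
  · refine ⟨_, hd.neg.congr_of_eventuallyEq ?_, ?_⟩
    · filter_upwards [Iio_mem_nhds h] with y hy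
      rw [signedGeomMean_of_gt hy]; rfl
    · have h1 := hap.2 x h
      have h2 := hbp.2 x h
      refine (hlog (div_pos (neg_pos.2 h2) hr) (div_pos (neg_pos.2 h1) hr) ?_).trans_eq ?_
      · rw [div_mul_div_comm, ← sq, hr2, div_eq_one_iff_eq hab.ne']; ring
      · simp only [Pi.mul_apply]; field_simp; ring
  · refine ⟨_, hd.congr_of_eventuallyEq ?_, ?_⟩
    · filter_upwards [Ioi_mem_nhds h] with y hy
      rw [signedGeomMean_of_lt hy]; rfl
    · have h1 := hap.1 x h
      have h2 := hbp.1 x h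
      refine (hlog (div_pos h2 hr) (div_pos h1 hr) ?_).trans_eq ?_
      · rw [div_mul_div_comm, ← sq, hr2, div_eq_one_iff_eq hab.ne']; ring
      · simp only [Pi.mul_apply]; field_simp

end

/-! ### Gibbs measures -/

section

variable {V : ℝ → ℝ}

theorem gibbs_absolutelyContinuous : gibbs V ≪ volume := withDensity_absolutelyContinuous _ _

theorem volume_absolutelyContinuous_gibbs (hV : Measurable V) : volume ≪ gibbs V :=
  withDensity_absolutelyContinuous' (by fun_prop)
    (ae_of_all _ fun x => by simpa using Real.exp_pos _)

theorem integrable_gibbs_iff (hV : Measurable V) {g : ℝ → ℝ} :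
    Integrable g (gibbs V) ↔ Integrable fun x => g x * Real.exp (-V x) := by
  rw [gibbs, integrable_withDensity_iff_integrable_smul' (by fun_prop)
    (ae_of_all _ fun _ => ENNReal.ofReal_lt_top)]
  simp only [ENNReal.toReal_ofReal (Real.exp_pos _).le, smul_eq_mul, mul_comm]

theorem integral_gibbs (hV : Measurable V) (g : ℝ → ℝ) :
    ∫ x, g x ∂(gibbs V) = ∫ x, g x * Real.exp (-V x) := by
  rw [gibbs, integral_withDensity_eq_integral_toReal_smul (by fun_prop)
    (ae_of_all _ fun _ => ENNReal.ofReal_lt_top)]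
  simp only [ENNReal.toReal_ofReal (Real.exp_pos _).le, smul_eq_mul, mul_comm]

theorem rnDeriv_gibbs (hV : Measurable V) :
    (gibbs V).rnDeriv volume =ᵐ[volume] fun x => ENNReal.ofReal (Real.exp (-V x)) :=
  Measure.rnDeriv_withDensity _ (by fun_prop)

/-- Strong convexity of `V` with constant `κ`, in the first-order form: `V` lies above its tangent
parabolas of curvature `κ`. -/
def AboveTangentParabolas (κ : ℝ) (V : ℝ → ℝ) : Prop :=
  ∀ x y, V x + deriv V x * (y - x) + κ / 2 * (y - x) ^ 2 ≤ V y

theorem aboveTangentParabolas_of_strongConvexOn {κ : ℝ} (hV : Differentiable ℝ V)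
    (hc : StrongConvexOn Set.univ κ V) : AboveTangentParabolas κ V := by
  intro x y
  rw [strongConvexOn_iff_convex] at hc
  simp only [Real.norm_eq_abs, sq_abs] at hc
  have hd : HasDerivAt (fun x => V x - κ / 2 * x ^ 2) (deriv V x - κ / 2 * (2 * x)) x := by
    have h := (hV x).hasDerivAt.sub ((hasDerivAt_pow 2 x).const_mul (κ / 2))
    simpa using! h
  rcases lt_trichotomy x y with h | rfl | h
  · have := hc.le_slope_of_hasDerivAt (mem_univ x) (mem_univ y) h hd
    rw [slope_def_field, le_div_iff₀ (by linarith)] at this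
    linarith
  · simp
  · have := hc.slope_le_of_hasDerivAt (mem_univ y) (mem_univ x) h hd
    rw [slope_def_field, div_le_iff₀ (by linarith)] at this
    linarith

theorem AboveTangentParabolas.mul_sq_le {κ : ℝ} (h : AboveTangentParabolas κ V) (x y : ℝ) :
    κ * (y - x) ^ 2 ≤ (deriv V y - deriv V x) * (y - x) := by
  linarith [h x y, h y x]

theorem AboveTangentParabolas.exists_deriv_eq_zero {κ : ℝ} (hκ : 0 < κ) (hV : ContDiff ℝ 1 V)
    (h : AboveTangentParabolas κ V) : ∃ ξ, deriv V ξ = 0 := by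
  have hc : Continuous (deriv V) := hV.continuous_deriv le_rfl
  set D := |deriv V 0| / κ + 1 with hD
  have hDpos : 0 < D := by positivity
  have hκD : |deriv V 0| ≤ κ * D := by
    rw [hD, mul_add, mul_div_cancel₀ _ hκ.ne']
    linarith
  have h1 := h.mul_sq_le 0 D
  have h2 := h.mul_sq_le 0 (-D)
  have h3 : κ * D ≤ deriv V D - deriv V 0 := by
    refine le_of_mul_le_mul_right ?_ hDpos
    linarith
  have h4 : κ * D ≤ deriv V 0 - deriv V (-D) := by
    refine le_of_mul_le_mul_right ?_ hDpos
    linarith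
  have h5 := neg_abs_le (deriv V 0)
  have h6 := le_abs_self (deriv V 0)
  exact mem_range_of_exists_le_of_exists_ge hc ⟨-D, by linarith⟩ ⟨D, by linarith⟩

theorem AboveTangentParabolas.isMode {κ : ℝ} (hκ : 0 < κ) (h : AboveTangentParabolas κ V) {ξ : ℝ}
    (hξ : deriv V ξ = 0) : IsMode (fun x => Real.exp (-V x)) ξ := by
  intro x hx
  have h1 := h ξ x
  have h2 : 0 < κ / 2 * (x - ξ) ^ 2 :=
    mul_pos (by positivity) (by have := sub_ne_zero.2 hx; positivity)
  rw [hξ] at h1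
  exact Real.exp_lt_exp.2 (by linarith)

theorem AboveTangentParabolas.isP2_gibbs {κ : ℝ} (hκ : 0 < κ) (hV : ContDiff ℝ 1 V)
    (h : AboveTangentParabolas κ V) (hp : IsProbabilityMeasure (gibbs V)) : IsP2 (gibbs V) := by
  refine ⟨hp, ?_⟩
  have hVm : Measurable V := hV.continuous.measurable
  obtain ⟨ξ, hξ⟩ := h.exists_deriv_eq_zero hκ hV
  suffices hs : MemLp (fun x => x - ξ) 2 (gibbs V) by
    exact (memLp_congr_ae (ae_of_all _ fun x => by simp)).1 (hs.add (memLp_const ξ))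
  rw [memLp_two_iff_integrable_sq (by fun_prop), integrable_gibbs_iff hVm]
  have hg : Integrable fun x : ℝ => Real.exp (-V ξ) *
      ((x - ξ) ^ (2 : ℝ) * Real.exp (-(κ / 2) * (x - ξ) ^ 2)) :=
    ((integrable_rpow_mul_exp_neg_mul_sq (half_pos hκ) (s := 2) (by norm_num)).comp_sub_right
      ξ).const_mul _
  refine hg.mono' (by fun_prop) (ae_of_all _ fun x => ?_)
  rw [Real.norm_of_nonneg (by positivity), Real.rpow_two, mul_left_comm, ← Real.exp_add]
  have := h ξ x
  rw [hξ] at this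
  gcongr
  linarith

/-! ### The density of a transported measure -/

theorem strictMono_of_map_ac {m μ : Measure ℝ} (hm : volume ≪ m) {S : ℝ → ℝ} (hS : Monotone S)
    (hSμ : m.map S = μ) (hμ : μ ≪ volume) : StrictMono S := by
  intro x y hxy
  refine lt_of_le_of_ne (hS hxy.le) fun h => ?_
  have h1 : m (S ⁻¹' {S x}) = 0 := by
    rw [← Measure.map_apply hS.measurable (measurableSet_singleton _), hSμ]
    exact hμ Real.volume_singleton
  have h2 : Ioc x y ⊆ S ⁻¹' {S x} := fun z hz =>
    le_antisymm ((hS hz.2).trans h.ge) (hS hz.1.le)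
  have h3 := hm (measure_mono_null h2 h1)
  rw [Real.volume_Ioc, ENNReal.ofReal_eq_zero] at h3
  linarith

/-- The change of variables formula for a monotone map `S` from `e^{-V}` to an absolutely continuous
measure. It is the chain rule for the distribution functions, `F_μ ∘ S = F_m`, and needs no
regularity of `S` beyond differentiability almost everywhere. -/
theorem ae_llr_comp_eq (hV : Measurable V) [IsProbabilityMeasure (gibbs V)] {μ : Measure ℝ}
    [IsProbabilityMeasure μ] (hμ : μ ≪ gibbs V) {S : ℝ → ℝ} (hS : Monotone S)
    (hSμ : (gibbs V).map S = μ) :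
    ∀ᵐ x, ∃ s, 0 < s ∧ HasDerivAt S s x ∧
      llr μ (gibbs V) (S x) = V (S x) - V x - Real.log s := by
  have hvol : volume ≪ gibbs V := volume_absolutelyContinuous_gibbs hV
  have hstrict : StrictMono S :=
    strictMono_of_map_ac hvol hS hSμ (hμ.trans gibbs_absolutelyContinuous)
  have hcdf (x : ℝ) : cdf μ (S x) = cdf (gibbs V) x := by
    rw [cdf_eq_real, cdf_eq_real, ← hSμ, map_measureReal_apply hS.measurable measurableSet_Iic]
    congr 1
    ext z
    exact hstrict.le_iff_le
  have hμd : ∀ᵐ y, HasDerivAt (cdf μ) (μ.rnDeriv volume y).toReal y ∧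
      μ.rnDeriv volume y = μ.rnDeriv (gibbs V) y * ENNReal.ofReal (Real.exp (-V y)) := by
    have h1 := (cdf μ).ae_hasDerivAt
    rw [measure_cdf] at h1
    filter_upwards [h1, Measure.rnDeriv_mul_rnDeriv (κ := volume) hμ, rnDeriv_gibbs hV]
      with y hy1 hy2 hy3
    refine ⟨hy1, ?_⟩
    rw [← hy2, Pi.mul_apply, hy3]
  have hμd' := (hμ.trans gibbs_absolutelyContinuous).ae_le hμd
  have hμx := hvol.ae_le (ae_of_ae_map (f := S) hS.measurable.aemeasurable (by rwa [hSμ]))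
  have hmd := (cdf (gibbs V)).ae_hasDerivAt
  rw [measure_cdf] at hmd
  filter_upwards [hμx, hmd, rnDeriv_gibbs hV, hS.ae_differentiableAt] with x ⟨h1, h2⟩ h3 h4 h5
  have hd := h5.hasDerivAt
  rw [h4, ENNReal.toReal_ofReal (Real.exp_pos _).le] at h3
  have hchain := h1.comp x hd
  rw [show cdf μ ∘ S = cdf (gibbs V) from funext hcdf] at hchain
  have heq := hchain.unique h3
  rw [h2, ENNReal.toReal_mul, ENNReal.toReal_ofReal (Real.exp_pos _).le] at heq
  set r := (μ.rnDeriv (gibbs V) (S x)).toReal with hr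
  have hr0 : 0 ≤ r := ENNReal.toReal_nonneg
  have hpos : r ≠ 0 ∧ deriv S x ≠ 0 := by
    constructor <;> intro h0 <;> rw [h0] at heq <;>
      simp [(Real.exp_pos (-V x)).ne] at heq
  have hs : 0 < deriv S x := lt_of_le_of_ne hS.deriv_nonneg hpos.2.symm
  refine ⟨deriv S x, hs, hd, ?_⟩
  have hlog := congrArg Real.log heq
  rw [Real.log_mul (mul_ne_zero hpos.1 (Real.exp_pos _).ne') hpos.2,
    Real.log_mul hpos.1 (Real.exp_pos _).ne', Real.log_exp, Real.log_exp] at hlog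
  rw [llr_def]
  simp only [← hr]
  linarith

end

/-! ### The symmetrized entropy inequality -/

section

variable {V : ℝ → ℝ} {μ ν : Measure ℝ} {S T : ℝ → ℝ}

theorem bary_eq_integral_of_map {m : Measure ℝ} (hS : Monotone S) (h : m.map S = μ) :
    bary μ = ∫ x, S x ∂m := by
  rw [bary, ← h, integral_map hS.measurable.aemeasurable (by fun_prop)]

/-- The quantity subtracted from the entropies integrates to `-κ Φ`. -/
theorem integral_eq_neg_mul_Phi {m : Measure ℝ} [IsProbabilityMeasure m]
    (hm : Integrable (fun x : ℝ => x) m) (hS : Monotone S) (hSμ : m.map S = μ)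
    (hSi : Integrable S m) (hT : Monotone T) (hTν : m.map T = ν) (hTi : Integrable T m)
    (κ ξ α β : ℝ) :
    Integrable (fun x => κ * ((α - ξ) * (T x - ξ) + (β - ξ) * (S x - ξ) - (α - ξ) * (β - ξ)
      - (α + β - 2 * ξ) * (x - ξ))) m ∧
    ∫ x, κ * ((α - ξ) * (T x - ξ) + (β - ξ) * (S x - ξ) - (α - ξ) * (β - ξ)
      - (α + β - 2 * ξ) * (x - ξ)) ∂m = -(κ * Phi m μ ν ξ α β) := by
  have heq : (fun x => κ * ((α - ξ) * (T x - ξ) + (β - ξ) * (S x - ξ) - (α - ξ) * (β - ξ)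
      - (α + β - 2 * ξ) * (x - ξ))) = fun x => ((κ * (α - ξ)) * T x + (κ * (β - ξ)) * S x)
        + (κ * (-(α + β - 2 * ξ)) * x + κ * ((α + β) * ξ - ξ ^ 2 - α * β)) := by
    ext x; ring
  have h1 : Integrable (fun x => (κ * (α - ξ)) * T x + (κ * (β - ξ)) * S x) m :=
    (hTi.const_mul _).add (hSi.const_mul _)
  have h2 : Integrable (fun x => κ * (-(α + β - 2 * ξ)) * x + κ * ((α + β) * ξ - ξ ^ 2 - α * β)) m :=
    (hm.const_mul _).add (integrable_const _)
  rw [heq]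
  refine ⟨h1.add h2, ?_⟩
  rw [integral_add h1 h2, integral_add (hTi.const_mul _) (hSi.const_mul _),
    integral_add (hm.const_mul _) (integrable_const _), integral_const_mul, integral_const_mul,
    integral_const_mul, integral_const, ← bary_eq_integral_of_map hS hSμ,
    ← bary_eq_integral_of_map hT hTν, ← bary]
  simp only [Phi, probReal_univ, smul_eq_mul]
  ring

/-- The inequality behind the theorem, for maps with a common crossing point `p`: `S - α` and
`T - β` change sign at `p`, and `V' - κ (x - ξ)` has the sign of `x - p`.

With `u` the signed geometric mean of `S - α` and `T - β`, strong convexity at `x`, evaluated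
at `S x` and `T x`, bounds the integrand from below by `2 (V' v - v')` with `v` equal to
`u - x` up to a constant, and `(V' v - v') e^{-V} = -(v e^{-V})'`. -/
theorem mul_integral_sq_le {κ : ℝ} (hκ : 0 ≤ κ) (hV : ContDiff ℝ 1 V)
    (hc : AboveTangentParabolas κ V) (hm : IsP2 (gibbs V)) (hμ : IsP2 μ) (hν : IsP2 ν)
    (hμac : μ ≪ gibbs V) (hνac : ν ≪ gibbs V) (hμi : Integrable (llr μ (gibbs V)) μ)
    (hνi : Integrable (llr ν (gibbs V)) ν)
    (hS : Monotone S) (hSμ : (gibbs V).map S = μ) (hT : Monotone T) (hTν : (gibbs V).map T = ν)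
    {ξ p α β : ℝ} (hSp : CrossesZeroAt (fun x => S x - α) p)
    (hTp : CrossesZeroAt (fun x => T x - β) p)
    (hright : ∀ x, p < x → κ * (x - ξ) ≤ deriv V x)
    (hleft : ∀ x, x < p → deriv V x ≤ κ * (x - ξ)) :
    κ / 2 * ∫ x, (S x - T x) ^ 2 ∂(gibbs V) ≤
      ∫ y, llr μ (gibbs V) y ∂μ + ∫ y, llr ν (gibbs V) y ∂ν + κ * Phi (gibbs V) μ ν ξ α β := by
  have := hm.isProbabilityMeasure
  have := hμ.isProbabilityMeasure
  have := hν.isProbabilityMeasure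
  have hVm : Measurable V := hV.continuous.measurable
  have hS2 := hμ.memLp_of_map hS hSμ
  have hT2 := hν.memLp_of_map hT hTν
  have hxi : Integrable (fun x : ℝ => x) (gibbs V) := hm.memLp.integrable (by norm_num)
  have hSi : Integrable S (gibbs V) := hS2.integrable (by norm_num)
  have hTi : Integrable T (gibbs V) := hT2.integrable (by norm_num)
  have hllm (μ : Measure ℝ) : AEStronglyMeasurable (llr μ (gibbs V)) μ :=
    (stronglyMeasurable_llr _ _).aestronglyMeasurable
  have hLS : Integrable (fun x => llr μ (gibbs V) (S x)) (gibbs V) := by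
    rw [← hSμ] at hμi
    simpa only [hSμ] using! hμi.comp_measurable hS.measurable
  have hLT : Integrable (fun x => llr ν (gibbs V) (T x)) (gibbs V) := by
    rw [← hTν] at hνi
    simpa only [hTν] using! hνi.comp_measurable hT.measurable
  have hLSint : ∫ y, llr μ (gibbs V) y ∂μ = ∫ x, llr μ (gibbs V) (S x) ∂(gibbs V) := by
    have h := integral_map (μ := gibbs V) hS.measurable.aemeasurable
      (by rw [hSμ]; exact hllm μ)
    rwa [hSμ] at h
  have hLTint : ∫ y, llr ν (gibbs V) y ∂ν = ∫ x, llr ν (gibbs V) (T x) ∂(gibbs V) := by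
    have h := integral_map (μ := gibbs V) hT.measurable.aemeasurable
      (by rw [hTν]; exact hllm ν)
    rwa [hTν] at h
  obtain ⟨hKi, hK⟩ := integral_eq_neg_mul_Phi hxi hS hSμ hSi hT hTν hTi κ ξ α β
  have hsq : Integrable (fun x => κ / 2 * (S x - T x) ^ 2) (gibbs V) :=
    (hS2.sub hT2).integrable_sq.const_mul _
  set K : ℝ → ℝ := fun x => κ * ((α - ξ) * (T x - ξ) + (β - ξ) * (S x - ξ) - (α - ξ) * (β - ξ)
      - (α + β - 2 * ξ) * (x - ξ)) with hKdef
  have hLi : Integrable (fun x => llr μ (gibbs V) (S x) + llr ν (gibbs V) (T x)) (gibbs V) :=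
    hLS.add hLT
  have hQi : Integrable (fun x => κ / 2 * (S x - T x) ^ 2 + K x) (gibbs V) := hsq.add hKi
  have hGi : Integrable (fun x => (llr μ (gibbs V) (S x) + llr ν (gibbs V) (T x))
      - (κ / 2 * (S x - T x) ^ 2 + K x)) (gibbs V) := hLi.sub hQi
  suffices hpos : 0 ≤ ∫ x, ((llr μ (gibbs V) (S x) + llr ν (gibbs V) (T x))
      - (κ / 2 * (S x - T x) ^ 2 + K x)) ∂(gibbs V) by
    rw [integral_sub hLi hQi, integral_add hLS hLT, integral_add hsq hKi, hK,
      integral_const_mul] at hpos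
    rw [hLSint, hLTint]
    linarith
  set a : ℝ → ℝ := fun x => S x - α with ha
  set b : ℝ → ℝ := fun x => T x - β with hb
  have ham : Monotone a := fun x y h => sub_le_sub_right (hS h) α
  have hbm : Monotone b := fun x y h => sub_le_sub_right (hT h) β
  set u := signedGeomMean p a b with hu
  have hum : Monotone u := monotone_signedGeomMean ham hbm hSp hTp
  have hui : Integrable u (gibbs V) := by
    have h1 : Integrable (fun x => |a x| + |b x|) (gibbs V) :=
      (hSi.sub (integrable_const α)).abs.add (hTi.sub (integrable_const β)).abs
    exact h1.mono' hum.measurable.aestronglyMeasurable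
      (ae_of_all _ fun x => abs_signedGeomMean_le hSp hTp x)
  -- the constant is chosen so that the terms linear in `V'` match
  set c : ℝ := (α + β - 2 * ξ) / 2 + ξ with hcdef
  set w : ℝ → ℝ := fun x => 2 * Real.exp (-V x) with hw
  have hwC : ContDiff ℝ 1 w := contDiff_const.mul hV.neg.exp
  set h : ℝ → ℝ := fun x => (c - x) * w x with hh
  have hhC : ContDiff ℝ 1 h := (contDiff_const.sub contDiff_id).mul hwC
  rw [integral_gibbs hVm]
  refine integral_nonneg_of_neg_deriv_le (f := fun x => u x * w x + h x) ?_
    ((integrable_gibbs_iff hVm).1 hGi) (fun R => ?_) ?_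
  · have h1 : Integrable (fun x => 2 * (u x + (c - x))) (gibbs V) :=
      (hui.add ((integrable_const c).sub hxi)).const_mul 2
    refine ((integrable_gibbs_iff hVm).1 h1).congr (ae_of_all _ fun x => ?_)
    simp only [hw, hh]
    ring
  · exact exists_monotoneOn_mul_add hum hwC (fun x => by positivity) hhC _ _
  · have hne : ∀ᵐ x : ℝ, x ≠ p := by simp [ae_iff]
    filter_upwards [ae_llr_comp_eq hVm hμac hS hSμ, ae_llr_comp_eq hVm hνac hT hTν, hne]
      with x ⟨s, hs, hSs, hllS⟩ ⟨t, ht, hTt, hllT⟩ hxp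
    obtain ⟨d, hd, hlog⟩ := exists_hasDerivAt_signedGeomMean hSp hTp hxp
      (hSs.sub_const α) (hTt.sub_const β) hs ht
    have hVd : HasDerivAt V (deriv V x) x :=
      (hV.differentiable one_ne_zero x).hasDerivAt
    have hwd : HasDerivAt w (2 * (Real.exp (-V x) * -deriv V x)) x := hVd.neg.exp.const_mul 2
    have hhd := ((hasDerivAt_id x).const_sub c).mul hwd
    refine ⟨_, (hd.mul hwd).add hhd, ?_⟩
    have hexp := Real.exp_pos (-V x)
    -- the remaining inequality after division by `e^{-V x}`
    have hmain : 2 * (deriv V x * (u x + (c - x)) - (d - 1)) ≤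
        (llr μ (gibbs V) (S x) + llr ν (gibbs V) (T x)) - (κ / 2 * (S x - T x) ^ 2 + K x) := by
      have hc1 := hc x (S x)
      have hc2 := hc x (T x)
      have husq : u x ^ 2 = (S x - α) * (T x - β) := signedGeomMean_sq hSp hTp hxp
      have hsign : 0 ≤ (deriv V x - κ * (x - ξ)) * (S x - α + (T x - β) - 2 * u x) := by
        rcases hxp.lt_or_gt with hlt | hgt
        · exact mul_nonneg_of_nonpos_of_nonpos (sub_nonpos.2 (hleft x hlt))
            (sub_nonpos.2 (le_two_mul_signedGeomMean hSp hTp hlt))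
        · exact mul_nonneg (sub_nonneg.2 (hright x hgt))
            (sub_nonneg.2 (two_mul_signedGeomMean_le hSp hTp hgt))
      have hκ0 : 0 ≤ κ * (u x - (x - ξ)) ^ 2 := by positivity
      rw [hllS, hllT]
      have hid : deriv V x * (S x - x) + κ / 2 * (S x - x) ^ 2
          + (deriv V x * (T x - x) + κ / 2 * (T x - x) ^ 2) - (κ / 2 * (S x - T x) ^ 2 + K x)
          - 2 * (deriv V x * (u x + (c - x)))
          = (deriv V x - κ * (x - ξ)) * (S x - α + (T x - β) - 2 * u x)
            + κ * (u x - (x - ξ)) ^ 2 := by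
        simp only [hKdef, hcdef]
        linear_combination (-κ) * husq
      linarith
    have := mul_le_mul_of_nonneg_right hmain hexp.le
    refine le_trans (le_of_eq ?_) this
    simp only [hw, id]
    ring

end

section

variable {V : ℝ → ℝ} {μ ν : Measure ℝ} {S T : ℝ → ℝ}

theorem _root_.StrictMono.crossesZeroAt_sub (hS : StrictMono S) (p : ℝ) :
    CrossesZeroAt (fun x => S x - S p) p :=
  ⟨fun _ hx => sub_pos.2 (hS hx), fun _ hx => sub_neg.2 (hS hx)⟩

/-- A strictly increasing function crosses its mean. -/
theorem exists_crossesZeroAt_sub_integral {m : Measure ℝ} [IsProbabilityMeasure m]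
    (hS : StrictMono S) (hSi : Integrable S m) :
    ∃ p, CrossesZeroAt (fun x => S x - ∫ z, S z ∂m) p := by
  set I := ∫ z, S z ∂m with hI
  obtain ⟨y, hy⟩ := exists_integral_le hSi
  have hne : {x | S x ≤ I}.Nonempty := exists_le_integral hSi
  have hbdd : BddAbove {x | S x ≤ I} := ⟨y, fun x hx => hS.le_iff_le.1 (hx.trans hy)⟩
  refine ⟨sSup {x | S x ≤ I}, fun x hx => ?_, fun x hx => ?_⟩
  · by_contra! h
    exact (le_csSup hbdd (sub_nonpos.1 h)).not_gt hx
  · obtain ⟨z, hz, hxz⟩ := exists_lt_of_lt_csSup hne hx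
    exact sub_neg.2 ((hS hxz).trans_le hz)

/-- The passage from real integrals to extended entropies and to the Wasserstein distance, for any
crossing data of the two maps. -/
theorem half_mul_W₂_sq_le {κ : ℝ} (hκ : 0 < κ) (hV : ContDiff ℝ 1 V)
    (hc : AboveTangentParabolas κ V) (hm : IsP2 (gibbs V)) (hμ : IsP2 μ) (hν : IsP2 ν)
    (hS : IsOptimalTransportMap (gibbs V) μ S) (hT : IsOptimalTransportMap (gibbs V) ν T)
    {ξ α β : ℝ}
    (hp : StrictMono S → StrictMono T → ∃ p, CrossesZeroAt (fun x => S x - α) p ∧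
      CrossesZeroAt (fun x => T x - β) p ∧ (∀ x, p < x → κ * (x - ξ) ≤ deriv V x) ∧
      ∀ x, x < p → deriv V x ≤ κ * (x - ξ)) :
    ((1 / 2 : ℝ) : EReal) * ((W₂ μ ν ^ 2 : ℝ≥0∞) : EReal) ≤
      ((1 / κ : ℝ) : EReal) * ((Ent (gibbs V) μ : EReal) + (Ent (gibbs V) ν : EReal)) +
        ((Phi (gibbs V) μ ν ξ α β : ℝ) : EReal) := by
  have := hm.isProbabilityMeasure
  have := hμ.isProbabilityMeasure
  have := hν.isProbabilityMeasure
  have hκ' : 0 < 1 / κ := by positivity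
  by_cases hμe : Ent (gibbs V) μ = ⊤
  · rw [hμe, EReal.coe_ennreal_top, EReal.top_add_of_ne_bot (EReal.coe_ennreal_ne_bot _),
      EReal.coe_mul_top_of_pos hκ', EReal.top_add_coe]
    exact le_top
  by_cases hνe : Ent (gibbs V) ν = ⊤
  · rw [hνe, EReal.coe_ennreal_top, EReal.add_top_of_ne_bot (EReal.coe_ennreal_ne_bot _),
      EReal.coe_mul_top_of_pos hκ', EReal.top_add_coe]
    exact le_top
  obtain ⟨hμac, hμi⟩ := InformationTheory.klDiv_ne_top_iff.1 hμe
  obtain ⟨hνac, hνi⟩ := InformationTheory.klDiv_ne_top_iff.1 hνe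
  have hvol := volume_absolutelyContinuous_gibbs hV.continuous.measurable
  have hSs := strictMono_of_map_ac hvol hS.monotone hS.map_eq
    (hμac.trans gibbs_absolutelyContinuous)
  have hTs := strictMono_of_map_ac hvol hT.monotone hT.map_eq
    (hνac.trans gibbs_absolutelyContinuous)
  obtain ⟨p, hSp, hTp, hr, hl⟩ := hp hSs hTs
  have hmain := mul_integral_sq_le hκ.le hV hc hm hμ hν hμac hνac hμi hνi hS.monotone hS.map_eq
    hT.monotone hT.map_eq hSp hTp hr hl
  have e1 : (Ent (gibbs V) μ).toReal = ∫ y, llr μ (gibbs V) y ∂μ :=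
    InformationTheory.toReal_klDiv_of_measure_eq hμac (by simp)
  have e2 : (Ent (gibbs V) ν).toReal = ∫ y, llr ν (gibbs V) y ∂ν :=
    InformationTheory.toReal_klDiv_of_measure_eq hνac (by simp)
  rw [← e1, ← e2] at hmain
  have hS2 := hμ.memLp_of_map hS.monotone hS.map_eq
  have hT2 := hν.memLp_of_map hT.monotone hT.map_eq
  have hW : W₂ μ ν ^ 2 ≤ ENNReal.ofReal (∫ x, (S x - T x) ^ 2 ∂(gibbs V)) :=
    (W₂_sq_le_of_map hS.monotone.measurable hT.monotone.measurable hS.map_eq hT.map_eq).trans_eq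
      (lintegral_enorm_sq_eq (hS2.sub hT2))
  have hWfin : W₂ μ ν ^ 2 ≠ ⊤ := ne_top_of_le_ne_top ENNReal.ofReal_ne_top hW
  have hWr := ENNReal.toReal_mono ENNReal.ofReal_ne_top hW
  rw [ENNReal.toReal_ofReal (integral_nonneg fun x => sq_nonneg _)] at hWr
  rw [← EReal.coe_ennreal_toReal hWfin, ← EReal.coe_ennreal_toReal hμe,
    ← EReal.coe_ennreal_toReal hνe]
  norm_cast
  have hdiv := mul_le_mul_of_nonneg_left hmain hκ'.le
  have hcancel : 1 / κ * κ = 1 := one_div_mul_cancel hκ.ne'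
  calc 1 / 2 * (W₂ μ ν ^ 2).toReal ≤ 1 / 2 * ∫ x, (S x - T x) ^ 2 ∂(gibbs V) := by gcongr
    _ = 1 / κ * (κ / 2 * ∫ x, (S x - T x) ^ 2 ∂(gibbs V)) := by field_simp
    _ ≤ _ := hdiv
    _ = _ := by rw [mul_add, ← mul_assoc (1 / κ) κ, hcancel, one_mul]

end

/-! ### The standard Gaussian measure -/

/-- The potential of the standard Gaussian measure. -/
noncomputable def gaussianPotential (x : ℝ) : ℝ := x ^ 2 / 2 + Real.log √(2 * Real.pi)

theorem exp_neg_gaussianPotential (x : ℝ) :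
    Real.exp (-gaussianPotential x) = gaussianPDFReal 0 1 x := by
  have : 0 < √(2 * Real.pi) := by positivity
  rw [gaussianPotential, neg_add, Real.exp_add, Real.exp_neg (Real.log _), Real.exp_log this,
    gaussianPDFReal_def, mul_comm]
  simp [neg_div]

theorem gibbs_gaussianPotential : gibbs gaussianPotential = gaussianReal 0 1 := by
  rw [gaussianReal_of_var_ne_zero 0 one_ne_zero, gibbs]
  simp only [exp_neg_gaussianPotential]
  rfl

theorem contDiff_gaussianPotential : ContDiff ℝ 1 gaussianPotential := by
  unfold gaussianPotential
  fun_prop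

theorem deriv_gaussianPotential (x : ℝ) : deriv gaussianPotential x = x := by
  have h : HasDerivAt gaussianPotential (2 * x / 2) x := by
    unfold gaussianPotential
    simpa using ((hasDerivAt_pow 2 x).div_const 2).add_const (Real.log √(2 * Real.pi))
  rw [h.deriv]
  ring

theorem aboveTangentParabolas_gaussianPotential :
    AboveTangentParabolas 1 gaussianPotential := by
  intro x y
  rw [deriv_gaussianPotential]
  simp only [gaussianPotential]
  linarith

theorem bary_gaussianReal : bary (gaussianReal 0 1) = 0 := integral_id_gaussianReal

theorem Phi_gaussianReal (μ ν : Measure ℝ) (α β : ℝ) :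
    Phi (gaussianReal 0 1) μ ν 0 α β = -β * bary μ - α * bary ν + α * β := by
  rw [Phi, bary_gaussianReal]
  ring

end SymTalagrand

open SymTalagrand

theorem theorem5p8 (μ ν : Measure ℝ) (hμ : SymTalagrand.IsP2 μ) (hν : SymTalagrand.IsP2 ν) :
    -- the general reference measure `m = e^{-V} dx`
    (∀ (κ : ℝ) (V : ℝ → ℝ), 0 < κ → ContDiff ℝ ∞ V → StrongConvexOn Set.univ κ V →
      IsProbabilityMeasure (SymTalagrand.gibbs V) →
      ∃ ξ : ℝ, SymTalagrand.IsMode (fun x => Real.exp (-V x)) ξ ∧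
        (∃ S, SymTalagrand.IsOptimalTransportMap (SymTalagrand.gibbs V) μ S) ∧
        (∃ T, SymTalagrand.IsOptimalTransportMap (SymTalagrand.gibbs V) ν T) ∧
        ∀ S T : ℝ → ℝ,
          SymTalagrand.IsOptimalTransportMap (SymTalagrand.gibbs V) μ S →
          SymTalagrand.IsOptimalTransportMap (SymTalagrand.gibbs V) ν T →
          ((1 / 2 : ℝ) : EReal) * ((SymTalagrand.W₂ μ ν ^ 2 : ℝ≥0∞) : EReal) ≤
            ((1 / κ : ℝ) : EReal) *
              ((SymTalagrand.Ent (SymTalagrand.gibbs V) μ : EReal) +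
                (SymTalagrand.Ent (SymTalagrand.gibbs V) ν : EReal)) +
            ((SymTalagrand.Phi (SymTalagrand.gibbs V) μ ν ξ (S ξ) (T ξ) : ℝ) : EReal)) ∧
    -- the standard Gaussian measure
    (SymTalagrand.IsMode (gaussianPDFReal 0 1) 0 ∧
      (∃ S, SymTalagrand.IsOptimalTransportMap (gaussianReal 0 1) μ S) ∧
      (∃ T, SymTalagrand.IsOptimalTransportMap (gaussianReal 0 1) ν T) ∧
      ∀ S T : ℝ → ℝ,
        SymTalagrand.IsOptimalTransportMap (gaussianReal 0 1) μ S →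
        SymTalagrand.IsOptimalTransportMap (gaussianReal 0 1) ν T →
        SymTalagrand.Phi (gaussianReal 0 1) μ ν 0 (S 0) (T 0) =
            -T 0 * SymTalagrand.bary μ - S 0 * SymTalagrand.bary ν + S 0 * T 0 ∧
        ((1 / 2 : ℝ) : EReal) * ((SymTalagrand.W₂ μ ν ^ 2 : ℝ≥0∞) : EReal) ≤
          (SymTalagrand.Ent (gaussianReal 0 1) μ : EReal) +
            (SymTalagrand.Ent (gaussianReal 0 1) ν : EReal) +
          ((min (SymTalagrand.Phi (gaussianReal 0 1) μ ν 0 (S 0) (T 0))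
            (-SymTalagrand.bary μ * SymTalagrand.bary ν) : ℝ) : EReal)) := by
  constructor
  · intro κ V hκ hV hc hprob
    have hV1 : ContDiff ℝ 1 V := hV.of_le (by simp)
    have hVm : Measurable V := hV.continuous.measurable
    have htan : AboveTangentParabolas κ V :=
      aboveTangentParabolas_of_strongConvexOn (hV1.differentiable one_ne_zero) hc
    obtain ⟨ξ, hξ⟩ := htan.exists_deriv_eq_zero hκ hV1
    have hm : IsP2 (gibbs V) := htan.isP2_gibbs hκ hV1 hprob
    have hvol := volume_absolutelyContinuous_gibbs hVm
    have : NullSingletonClass (gibbs V) :=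
      ⟨fun x => gibbs_absolutelyContinuous Real.volume_singleton⟩
    refine ⟨ξ, htan.isMode hκ hξ, exists_isOptimalTransportMap hvol hm hμ,
      exists_isOptimalTransportMap hvol hm hν, fun S T hS hT => ?_⟩
    refine half_mul_W₂_sq_le hκ hV1 htan hm hμ hν hS hT fun hSs hTs =>
      ⟨ξ, hSs.crossesZeroAt_sub ξ, hTs.crossesZeroAt_sub ξ, fun x hx => ?_, fun x hx => ?_⟩
    · have h := htan.mul_sq_le ξ x
      rw [hξ, sub_zero, sq, ← mul_assoc] at h
      exact le_of_mul_le_mul_right h (sub_pos.2 hx)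
    · have h := htan.mul_sq_le ξ x
      rw [hξ, sub_zero, sq, ← mul_assoc] at h
      by_contra! hlt
      exact (mul_lt_mul_of_neg_right hlt (sub_neg.2 hx)).not_ge h
  · have hm : IsP2 (gaussianReal 0 1) := ⟨inferInstance, memLp_id_gaussianReal 2⟩
    have hvol : volume ≪ gaussianReal 0 1 := gaussianReal_absolutelyContinuous' 0 one_ne_zero
    have : NullSingletonClass (gaussianReal 0 1) := nullSingletonClass_gaussianReal one_ne_zero
    have htan := aboveTangentParabolas_gaussianPotential
    refine ⟨?_, exists_isOptimalTransportMap hvol hm hμ, exists_isOptimalTransportMap hvol hm hν,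
      fun S T hS hT => ⟨Phi_gaussianReal μ ν _ _, ?_⟩⟩
    · have h := htan.isMode one_pos (deriv_gaussianPotential 0)
      simpa only [exp_neg_gaussianPotential] using h
    have key {α β : ℝ} (hp : StrictMono S → StrictMono T →
        ∃ p, CrossesZeroAt (fun x => S x - α) p ∧ CrossesZeroAt (fun x => T x - β) p) :
        ((1 / 2 : ℝ) : EReal) * ((W₂ μ ν ^ 2 : ℝ≥0∞) : EReal) ≤
          (Ent (gaussianReal 0 1) μ : EReal) + (Ent (gaussianReal 0 1) ν : EReal) +
            ((Phi (gaussianReal 0 1) μ ν 0 α β : ℝ) : EReal) := by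
      rw [← gibbs_gaussianPotential] at hm hS hT ⊢
      have h := half_mul_W₂_sq_le one_pos contDiff_gaussianPotential htan hm hμ hν hS hT
        (ξ := 0) (α := α) (β := β) fun hSs hTs => by
          obtain ⟨p, h1, h2⟩ := hp hSs hTs
          exact ⟨p, h1, h2, fun x _ => by simp [deriv_gaussianPotential],
            fun x _ => by simp [deriv_gaussianPotential]⟩
      simpa using h
    rcases min_choice (Phi (gaussianReal 0 1) μ ν 0 (S 0) (T 0)) (-bary μ * bary ν) with h | h
    · rw [h]
      exact key fun hSs hTs => ⟨0, hSs.crossesZeroAt_sub 0, hTs.crossesZeroAt_sub 0⟩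
    · rw [h]
      have hSi : Integrable S (gaussianReal 0 1) :=
        (hμ.memLp_of_map hS.monotone hS.map_eq).integrable (by norm_num)
      -- for `α = bar μ` the correction term does not depend on `β`
      have hΦ (β : ℝ) : Phi (gaussianReal 0 1) μ ν 0 (bary μ) β = -bary μ * bary ν := by
        rw [Phi_gaussianReal]
        ring
      by_cases hSs : StrictMono S
      · obtain ⟨p, hp⟩ := exists_crossesZeroAt_sub_integral hSs hSi
        rw [← bary_eq_integral_of_map hS.monotone hS.map_eq] at hp
        rw [← hΦ (T p)]
        exact key fun _ hTs => ⟨p, hp, hTs.crossesZeroAt_sub p⟩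
      -- if `S` is constant on an interval, then `μ` has an atom and infinite entropy
      · rw [← hΦ 0]
        exact key fun h => absurd h hSs
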